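/- Let $d\ge 1$, $\|\mathbf x\|_1=\sum_{i=1}^d|x_i|$ and $\|\mathbf x\|_\infty=\max_{1\le i\le d}|x_i|$ for $\mathbf x\in\mathbb R^d$; products of vectors are componentwise. A norm $\|\cdot\|_D$ on $\mathbb R^d$ is a *$D$-norm* if there is a random vector $\mathbf Z=(Z_1,\dots,Z_d)$ (a *generator* of $\|\cdot\|_D$) with $Z_i\ge 0$ a.s. and $E(Z_i)=1$ for $1\le i\le d$ such that $\|\mathbf x\|_D=E(\|\mathbf x\mathbf Z\|_\infty)$ for all $\mathbf x\in\mathbb R^d$. A generator is *normalized* if $\|\mathbf Z\|_1=d$ a.s. Let $\mathbb D$ be the set of $D$-norms on $\mathbb R^d$, and put $$d_W(\|\cdot\|_{D_1},\|\cdot\|_{D_2})=\inf E\big(\|\mathbf Z^{(1)}-\mathbf Z^{(2)}\|_1\big),$$ the infimum being over all pairs $(\mathbf Z^{(1)},\mathbf Z^{(2)})$ of random vectors on a common probability space such that $\mathbf Z^{(i)}$ is a normalized generator of $\|\cdot\|_{D_i}$, $i=1,2$. Let $S_d=\{\mathbf x\in\mathbb R^d:\mathbf x\ge\mathbf 0,\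 \|\mathbf x\|_1=d\}$, let $\mathbb P$ be the set of Borel probability measures on $S_d$, and put $$d_W(P,Q)=\inf\{E(\|\mathbf X-\mathbf Y\|_1):\ \mathbf X\text{ has distribution }P,\ \mathbf Y\text{ has distribution }Q\},$$ the infimum being over all such pairs $(\mathbf X,\mathbf Y)$ on a common probability space. Let $\mathbb P_D$ be the set of all $P\in\mathbb P$ with $\int_{S_d}x_i\,P(d\mathbf x)=1$ for $i=1,\dots,d$. Then: 1. $d_W$ is a metric on $\mathbb P$, and $(\mathbb P,d_W)$ is complete and separable. 2. $\mathbb P_D$ is closed in $(\mathbb P,d_W)$, and the subspace $(\mathbb P_D,d_W)$ is complete and separable. 3. Every $D$-norm has a normalized generator, and all normalized generators of it have the same distribution, which, regarded as a law on $S_d$, belongs to $\mathbb P_D$. The resulting map $\mathbb D\to\mathbb P_D$ is a bijection. 4. $d_W$ is a metric on $\mathbb D$, the bijection in 3 is an isometry from $(\mathbb D,d_W)$ onto $(\mathbb P_D,d_W)$, and $(\mathbb D,d_W)$ is a complete separable metric space. -/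

import Mathlib

open MeasureTheory ProbabilityTheory

noncomputable section

/-- The `ℓ¹`-norm `‖x‖₁ = ∑ᵢ |xᵢ|` on `ℝᵈ`. -/
def l1Norm {d : ℕ} (x : Fin d → ℝ) : ℝ := ∑ i, |x i|

/-- `Z` is a generator of the functional `N` on `ℝᵈ`: a random vector with almost surely
nonnegative components of mean one and `N x = E (max_i |x_i Z_i|)`.
The norm on `Fin d → ℝ` below is the sup-norm, and `x * Z ω` is the componentwise product. -/
structure IsGenerator {d : ℕ} {Ω : Type*} [MeasurableSpace Ω] (μ : Measure Ω)
    (Z : Ω → Fin d → ℝ) (N : (Fin d → ℝ) → ℝ) : Prop where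
  aemeasurable : AEMeasurable Z μ
  nonneg : ∀ᵐ ω ∂μ, ∀ i, 0 ≤ Z ω i
  integrable : ∀ i, Integrable (fun ω => Z ω i) μ
  mean_one : ∀ i, ∫ ω, Z ω i ∂μ = 1
  eq_integral : ∀ x, N x = ∫ ω, ‖x * Z ω‖ ∂μ

/-- A generator `Z` of `N` that satisfies in addition `‖Z‖₁ = d` almost surely. -/
def IsNormalizedGenerator {d : ℕ} {Ω : Type*} [MeasurableSpace Ω] (μ : Measure Ω)
    (Z : Ω → Fin d → ℝ) (N : (Fin d → ℝ) → ℝ) : Prop :=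
  IsGenerator μ Z N ∧ ∀ᵐ ω ∂μ, l1Norm (Z ω) = d

/-- The set of `D`-norms on `ℝᵈ`: the norms (definite seminorms) on `ℝᵈ` that possess a generator,
defined on some probability space. -/
def DNorm (d : ℕ) : Type :=
  {N : Seminorm ℝ (Fin d → ℝ) // (∀ x, N x = 0 → x = 0) ∧
    ∃ (Ω : Type) (_ : MeasurableSpace Ω) (μ : Measure Ω) (_ : IsProbabilityMeasure μ)
      (Z : Ω → Fin d → ℝ), IsGenerator μ Z N}

/-- The norm on `ℝᵈ` underlying a `D`-norm, as a function. -/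
def DNorm.toFun {d : ℕ} (D : DNorm d) : (Fin d → ℝ) → ℝ := fun x => D.1 x

/-- The distance of two `D`-norms: the infimum of `E ‖Z₁ - Z₂‖₁` over all pairs of random vectors
on a common probability space such that `Zₖ` generates `Dₖ` and `‖Zₖ‖₁ = d`, for `k = 1, 2`. -/
def DNorm.distW {d : ℕ} (D₁ D₂ : DNorm d) : ℝ :=
  sInf {r : ℝ | ∃ (Ω : Type) (_ : MeasurableSpace Ω) (μ : Measure Ω) (_ : IsProbabilityMeasure μ)
    (Z₁ Z₂ : Ω → Fin d → ℝ), IsNormalizedGenerator μ Z₁ D₁.toFun ∧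
      IsNormalizedGenerator μ Z₂ D₂.toFun ∧ r = ∫ ω, l1Norm (Z₁ ω - Z₂ ω) ∂μ}

/-- The simplex `S_d = {x ≥ 0 : ‖x‖₁ = d}` in `ℝᵈ`. -/
def scaledSimplex (d : ℕ) : Set (Fin d → ℝ) := {x | (∀ i, 0 ≤ x i) ∧ l1Norm x = d}

/-- The set of all (Borel) probability measures on `S_d`. This is a type of its own, so that it
does not carry the topology of weak convergence as an instance. -/
def SimplexLaw (d : ℕ) : Type := ProbabilityMeasure (scaledSimplex d)

/-- The probability measure on `S_d` underlying an element of `SimplexLaw d`. -/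
def SimplexLaw.toMeasure {d : ℕ} (P : SimplexLaw d) : Measure (scaledSimplex d) := P.1

/-- The Wasserstein distance of order one on the probability measures on `S_d`: the infimum of
`E ‖X - Y‖₁` over all pairs of random variables on a common probability space such that `X` has
distribution `P` and `Y` has distribution `Q`. -/
def SimplexLaw.distW {d : ℕ} (P Q : SimplexLaw d) : ℝ :=
  sInf {r : ℝ | ∃ (Ω : Type) (_ : MeasurableSpace Ω) (μ : Measure Ω) (_ : IsProbabilityMeasure μ)
    (X Y : Ω → scaledSimplex d), HasLaw X P.toMeasure μ ∧ HasLaw Y Q.toMeasure μ ∧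
      r = ∫ ω, l1Norm ((X ω : Fin d → ℝ) - (Y ω : Fin d → ℝ)) ∂μ}

/-- The set of the probability measures on `S_d` all of whose means are equal to one. -/
def meanOneLaws (d : ℕ) : Set (SimplexLaw d) :=
  {P | ∀ i, ∫ z, (z : Fin d → ℝ) i ∂P.toMeasure = 1}

end

noncomputable section

open Filter Topology

/-! ### The ℓ¹-norm and the compact simplex -/

section SimplexBasics

variable {d : ℕ}

/-! The simplex is compact, so the laws on its square are weakly compact and couplings of `P` and
`Q` form a closed set on which the cost is continuous. Hence optimal couplings exist
(`exists_optimal_coupling`). They give the metric axioms, with gluing (`exists_gluing`) for the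
triangle inequality. For completeness, a Cauchy sequence has a weak limit along an ultrafilter, and
Wasserstein bounds pass to that limit. For separability, each law is realized on the unit interval,
and the law is a Lipschitz function of its representative in L¹. Coordinate means are 1-Lipschitz,
so the laws with means one form a closed set.

A generator `Z` becomes normalized when the measure is weighted by ‖Z‖₁/d and `Z` is rescaled to
‖Z‖₁ = d, since the D-norm is homogeneous in `Z`. For uniqueness, the left derivative at t = 1 of t
↦ E max(t Z_k, M), with M = max over i ≠ k of |c_i Z_i|, is E(Z_k; M < Z_k). So the norm determines
the measure z_k P(dz) on boxes in the ratios z_i/z_k, hence everywhere, and summing over k recovers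
d·P (`measure_eq_of_integral_norm_mul_eq`). Thus D-norms correspond to laws with means one, and both
Wasserstein distances are infima of the same set. -/

theorem l1Norm_nonneg (x : Fin d → ℝ) : 0 ≤ l1Norm x :=
  Finset.sum_nonneg fun _ _ => abs_nonneg _

@[fun_prop]
theorem continuous_l1Norm : Continuous (l1Norm : (Fin d → ℝ) → ℝ) := by
  unfold l1Norm
  fun_prop

theorem l1Norm_sub_comm (x y : Fin d → ℝ) : l1Norm (x - y) = l1Norm (y - x) := by
  simp [l1Norm, abs_sub_comm]

theorem l1Norm_sub_le (x y z : Fin d → ℝ) :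
    l1Norm (x - z) ≤ l1Norm (x - y) + l1Norm (y - z) := by
  simp only [l1Norm, Pi.sub_apply, ← Finset.sum_add_distrib]
  exact Finset.sum_le_sum fun i _ => abs_sub_le _ _ _

theorem abs_le_l1Norm (x : Fin d → ℝ) (i : Fin d) : |x i| ≤ l1Norm x :=
  Finset.single_le_sum (f := fun i => |x i|) (fun _ _ => abs_nonneg _) (Finset.mem_univ i)

theorem l1Norm_eq_zero_iff {x : Fin d → ℝ} : l1Norm x = 0 ↔ x = 0 := by
  refine ⟨fun h => funext fun i => ?_, fun h => by simp [h, l1Norm]⟩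
  exact abs_eq_zero.1 (le_antisymm (h ▸ abs_le_l1Norm x i) (abs_nonneg _))

theorem l1Norm_le_card_mul_norm (x : Fin d → ℝ) : l1Norm x ≤ d * ‖x‖ := by
  calc l1Norm x ≤ ∑ _i : Fin d, ‖x‖ := Finset.sum_le_sum fun i _ => norm_le_pi_norm x i
    _ = d * ‖x‖ := by simp

theorem isClosed_scaledSimplex : IsClosed (scaledSimplex d) := by
  have h : scaledSimplex d = (⋂ i, {x | 0 ≤ x i}) ∩ {x | l1Norm x = d} := by
    ext x; simp [scaledSimplex]
  rw [h]
  exact (isClosed_iInter fun i => isClosed_le continuous_const (continuous_apply i)).inter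
    (isClosed_eq continuous_l1Norm continuous_const)

theorem norm_le_of_mem_scaledSimplex {x : Fin d → ℝ} (hx : x ∈ scaledSimplex d) : ‖x‖ ≤ d :=
  (pi_norm_le_iff_of_nonneg (Nat.cast_nonneg d)).2 fun i => hx.2 ▸ abs_le_l1Norm x i

instance : CompactSpace (scaledSimplex d) := by
  refine isCompact_iff_compactSpace.1 (Metric.isCompact_of_isClosed_isBounded
    isClosed_scaledSimplex ?_)
  exact isBounded_iff_forall_norm_le.2 ⟨d, fun x hx => norm_le_of_mem_scaledSimplex hx⟩

instance : StandardBorelSpace (scaledSimplex d) :=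
  isClosed_scaledSimplex.measurableSet.standardBorel

instance (P : SimplexLaw d) : IsProbabilityMeasure P.toMeasure := P.2

theorem SimplexLaw.toMeasure_injective :
    Function.Injective (SimplexLaw.toMeasure : SimplexLaw d → _) :=
  fun _ _ h => Subtype.ext h

theorem SimplexLaw.nonempty (P : SimplexLaw d) : Nonempty (scaledSimplex d) :=
  ProbabilityMeasure.nonempty P

/-- The continuous function `(x, y) ↦ ‖x - y‖₁` on `S_d × S_d`. -/
def l1Cost (d : ℕ) : C(scaledSimplex d × scaledSimplex d, ℝ) where
  toFun p := l1Norm ((p.1 : Fin d → ℝ) - (p.2 : Fin d → ℝ))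
  continuous_toFun := by fun_prop

theorem integrable_l1Cost (π : Measure (scaledSimplex d × scaledSimplex d)) [IsFiniteMeasure π] :
    Integrable (l1Cost d) π :=
  (BoundedContinuousFunction.mkOfCompact (l1Cost d)).integrable π

end SimplexBasics

/-! ### Optimal couplings and the Wasserstein space -/

section Coupling

variable {d : ℕ}

/-- The probability measures on `S_d × S_d` with marginals `P` and `Q`. -/
def couplings (P Q : SimplexLaw d) : Set (ProbabilityMeasure (scaledSimplex d × scaledSimplex d)) :=
  {π | HasLaw Prod.fst P.toMeasure π.toMeasure ∧ HasLaw Prod.snd Q.toMeasure π.toMeasure}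

theorem bddBelow_distW (P Q : SimplexLaw d) :
    BddBelow {r : ℝ | ∃ (Ω : Type) (_ : MeasurableSpace Ω) (μ : Measure Ω)
      (_ : IsProbabilityMeasure μ) (X Y : Ω → scaledSimplex d), HasLaw X P.toMeasure μ ∧
        HasLaw Y Q.toMeasure μ ∧
        r = ∫ ω, l1Norm ((X ω : Fin d → ℝ) - (Y ω : Fin d → ℝ)) ∂μ} := by
  refine ⟨0, ?_⟩
  rintro r ⟨Ω, _, μ, _, X, Y, _, _, rfl⟩
  exact integral_nonneg fun _ => l1Norm_nonneg _

theorem SimplexLaw.distW_le {P Q : SimplexLaw d} {Ω : Type} [MeasurableSpace Ω] {μ : Measure Ω}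
    [IsProbabilityMeasure μ] {X Y : Ω → scaledSimplex d} (hX : HasLaw X P.toMeasure μ)
    (hY : HasLaw Y Q.toMeasure μ) :
    P.distW Q ≤ ∫ ω, l1Norm ((X ω : Fin d → ℝ) - (Y ω : Fin d → ℝ)) ∂μ :=
  csInf_le (bddBelow_distW P Q) ⟨Ω, _, μ, ‹_›, X, Y, hX, hY, rfl⟩

theorem SimplexLaw.distW_le_coupling {P Q : SimplexLaw d}
    {π : ProbabilityMeasure (scaledSimplex d × scaledSimplex d)} (hπ : π ∈ couplings P Q) :
    P.distW Q ≤ ∫ p, l1Cost d p ∂π.toMeasure :=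
  SimplexLaw.distW_le hπ.1 hπ.2

theorem couplings_nonempty (P Q : SimplexLaw d) : (couplings P Q).Nonempty :=
  ⟨⟨P.toMeasure.prod Q.toMeasure, inferInstance⟩,
    ⟨measurePreserving_fst.hasLaw, measurePreserving_snd.hasLaw⟩⟩

/-- Both marginals depend weakly continuously on the joint law, and points are closed in the weak
topology. -/
theorem isClosed_couplings (P Q : SimplexLaw d) : IsClosed (couplings P Q) := by
  let P' : ProbabilityMeasure (scaledSimplex d) := P
  let Q' : ProbabilityMeasure (scaledSimplex d) := Q
  have h : couplings P Q =
      {π | π.map (measurable_fst.aemeasurable) = P'} ∩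
        {π | π.map (measurable_snd.aemeasurable) = Q'} := by
    ext π
    exact and_congr
      ⟨fun h => Subtype.ext h.map_eq,
        fun h => ⟨measurable_fst.aemeasurable, congrArg Subtype.val h⟩⟩
      ⟨fun h => Subtype.ext h.map_eq,
        fun h => ⟨measurable_snd.aemeasurable, congrArg Subtype.val h⟩⟩
  rw [h]
  exact (isClosed_eq (ProbabilityMeasure.continuous_map continuous_fst) continuous_const).inter
    (isClosed_eq (ProbabilityMeasure.continuous_map continuous_snd) continuous_const)

/-- The infimum in the definition of the Wasserstein distance is attained. -/
theorem exists_optimal_coupling (P Q : SimplexLaw d) :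
    ∃ π ∈ couplings P Q, ∫ p, l1Cost d p ∂π.toMeasure = P.distW Q := by
  obtain ⟨π, hπ, hmin⟩ := (isClosed_couplings P Q).isCompact.exists_isMinOn
    (couplings_nonempty P Q)
    (ProbabilityMeasure.continuous_integral_continuousMap (l1Cost d)).continuousOn
  refine ⟨π, hπ, le_antisymm (le_csInf ?_ ?_) (SimplexLaw.distW_le_coupling hπ)⟩
  · exact ⟨_, _, _, π.toMeasure, inferInstance, Prod.fst, Prod.snd, hπ.1, hπ.2, rfl⟩
  · rintro r ⟨Ω, _, μ, _, X, Y, hX, hY, rfl⟩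
    -- Only the joint law of a competing pair matters, and it is a coupling.
    have hXY : AEMeasurable (fun ω => (X ω, Y ω)) μ := hX.aemeasurable.prodMk hY.aemeasurable
    let ρ : ProbabilityMeasure (scaledSimplex d × scaledSimplex d) :=
      ⟨μ.map fun ω => (X ω, Y ω), Measure.isProbabilityMeasure_map hXY⟩
    have hρ : ρ ∈ couplings P Q := by
      refine ⟨⟨by fun_prop, ?_⟩, ⟨by fun_prop, ?_⟩⟩
      · rw [← hX.map_eq]
        exact AEMeasurable.map_map_of_aemeasurable (by fun_prop) hXY
      · rw [← hY.map_eq]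
        exact AEMeasurable.map_map_of_aemeasurable (by fun_prop) hXY
    refine (hmin hρ).trans_eq ?_
    exact integral_map hXY (l1Cost d).continuous.aestronglyMeasurable

theorem SimplexLaw.distW_nonneg (P Q : SimplexLaw d) : 0 ≤ P.distW Q := by
  obtain ⟨π, -, h⟩ := exists_optimal_coupling P Q
  exact h ▸ integral_nonneg fun _ => l1Norm_nonneg _

theorem SimplexLaw.distW_self (P : SimplexLaw d) : P.distW P = 0 := by
  refine le_antisymm ?_ (P.distW_nonneg P)
  refine (SimplexLaw.distW_le (μ := P.toMeasure) (X := id) (Y := id)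
    HasLaw.id HasLaw.id).trans_eq ?_
  simp [l1Norm]

theorem SimplexLaw.distW_comm (P Q : SimplexLaw d) : P.distW Q = Q.distW P := by
  suffices h : ∀ P Q : SimplexLaw d, P.distW Q ≤ Q.distW P from le_antisymm (h P Q) (h Q P)
  intro P Q
  obtain ⟨π, hπ, h⟩ := exists_optimal_coupling Q P
  rw [← h]
  refine (SimplexLaw.distW_le hπ.2 hπ.1).trans_eq ?_
  exact integral_congr_ae (ae_of_all _ fun p => l1Norm_sub_comm _ _)

/-- An optimal coupling of cost zero is concentrated on the diagonal, so its marginals agree. -/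
theorem SimplexLaw.eq_of_distW_eq_zero {P Q : SimplexLaw d} (h : P.distW Q = 0) : P = Q := by
  obtain ⟨π, hπ, hc⟩ := exists_optimal_coupling P Q
  rw [h, integral_eq_zero_iff_of_nonneg (f := l1Cost d) (fun _ => l1Norm_nonneg _)
    (integrable_l1Cost _)] at hc
  apply SimplexLaw.toMeasure_injective
  rw [← hπ.1.map_eq, ← hπ.2.map_eq]
  refine Measure.map_congr ?_
  filter_upwards [hc] with p hp
  exact Subtype.ext (sub_eq_zero.1 (l1Norm_eq_zero_iff.1 hp))

/-- Two couplings with a common marginal can be realized on one probability space. -/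
theorem exists_gluing {α : Type} [MeasurableSpace α] [StandardBorelSpace α] [Nonempty α]
    (π₁ π₂ : Measure (α × α)) [IsProbabilityMeasure π₁] [IsProbabilityMeasure π₂]
    (h : π₁.map Prod.snd = π₂.map Prod.fst) :
    ∃ ρ : Measure ((α × α) × α), IsProbabilityMeasure ρ ∧ HasLaw Prod.fst π₁ ρ ∧
      HasLaw (fun p => (p.1.2, p.2)) π₂ ρ := by
  -- The third coordinate is drawn from the conditional law of `π₂`, given the middle coordinate
  -- only; disintegration then makes the last two coordinates have law `π₂`.
  let κ : Kernel (α × α) α := π₂.condKernel.comap Prod.snd measurable_snd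
  have hfst : HasLaw Prod.fst π₁ (π₁ ⊗ₘ κ) := ⟨by fun_prop, Measure.fst_compProd _ _⟩
  refine ⟨π₁ ⊗ₘ κ, inferInstance, hfst, ?_⟩
  have hκ : HasCondDistrib Prod.snd Prod.fst κ (π₁ ⊗ₘ κ) := by
    refine ⟨by fun_prop, ?_⟩
    rw [hfst.map_eq]
    exact Measure.map_id
  have h2 := hκ.comp_right
  have h3 : (π₁ ⊗ₘ κ).map (Prod.snd ∘ Prod.fst) = π₂.fst := by
    rw [← Measure.map_map measurable_snd measurable_fst, hfst.map_eq, h]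
    rfl
  have h4 : HasLaw _ _ _ := h2
  rw [h3, Measure.disintegrate] at h4
  exact h4

theorem SimplexLaw.distW_triangle (P Q R : SimplexLaw d) :
    P.distW R ≤ P.distW Q + Q.distW R := by
  have := P.nonempty
  obtain ⟨π₁, hπ₁, h₁⟩ := exists_optimal_coupling P Q
  obtain ⟨π₂, hπ₂, h₂⟩ := exists_optimal_coupling Q R
  obtain ⟨ρ, _, hρ₁, hρ₂⟩ := exists_gluing π₁.toMeasure π₂.toMeasure
    (hπ₁.2.map_eq.trans hπ₂.1.map_eq.symm)
  have e₁ : ∫ p, l1Cost d p.1 ∂ρ = P.distW Q := by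
    rw [← h₁]
    exact hρ₁.integral_comp (l1Cost d).continuous.aestronglyMeasurable
  have e₂ : ∫ p, l1Cost d (p.1.2, p.2) ∂ρ = Q.distW R := by
    rw [← h₂]
    exact hρ₂.integral_comp (l1Cost d).continuous.aestronglyMeasurable
  have i₁ : Integrable (fun p => l1Cost d p.1) ρ :=
    (integrable_l1Cost _).comp_aemeasurable hρ₁.aemeasurable
  have i₂ : Integrable (fun p : (scaledSimplex d × scaledSimplex d) × scaledSimplex d =>
      l1Cost d (p.1.2, p.2)) ρ :=
    (integrable_l1Cost _).comp_aemeasurable hρ₂.aemeasurable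
  rw [← e₁, ← e₂, ← integral_add i₁ i₂]
  refine (SimplexLaw.distW_le (hπ₁.1.comp hρ₁) (hπ₂.2.comp hρ₂)).trans ?_
  refine integral_mono_of_nonneg (ae_of_all _ fun _ => l1Norm_nonneg _) (i₁.add i₂)
    (ae_of_all _ fun p => ?_)
  exact l1Norm_sub_le _ _ _

/-- The Wasserstein metric on the laws on `S_d`. -/
@[reducible] def SimplexLaw.metricSpace (d : ℕ) : MetricSpace (SimplexLaw d) where
  dist := SimplexLaw.distW
  dist_self := SimplexLaw.distW_self
  dist_comm := SimplexLaw.distW_comm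
  dist_triangle := SimplexLaw.distW_triangle
  eq_of_dist_eq_zero := SimplexLaw.eq_of_distW_eq_zero

attribute [local instance] SimplexLaw.metricSpace

theorem SimplexLaw.dist_def (P Q : SimplexLaw d) : dist P Q = P.distW Q := rfl

/-- The Wasserstein distance to a weak limit is bounded by the limiting bound. -/
theorem SimplexLaw.distW_le_of_tendsto {ι : Type*} {F : Ultrafilter ι}
    {u : ι → ProbabilityMeasure (scaledSimplex d)} {Q : ProbabilityMeasure (scaledSimplex d)}
    (hu : Tendsto u F (𝓝 Q)) (P : SimplexLaw d) {r : ℝ}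
    (hr : ∀ᶠ i in F, P.distW (u i) ≤ r) : P.distW Q ≤ r := by
  choose π hπ hc using fun i => exists_optimal_coupling P (u i)
  -- A weak limit of optimal couplings couples `P` with `Q`, and its cost is the limit of their
  -- costs.
  obtain ⟨σ, -, hσ⟩ := isCompact_univ.ultrafilter_le_nhds (F.map π) (by simp)
  replace hσ : Tendsto π F (𝓝 σ) := hσ
  have hcost := ((ProbabilityMeasure.continuous_integral_continuousMap (l1Cost d)).tendsto σ).comp hσ
  have h1 := ProbabilityMeasure.tendsto_map_of_tendsto_of_continuous _ _ hσ continuous_fst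
  have h2 := ProbabilityMeasure.tendsto_map_of_tendsto_of_continuous _ _ hσ continuous_snd
  have e1 : ∀ i, (π i).map measurable_fst.aemeasurable = (show ProbabilityMeasure _ from P) :=
    fun i => Subtype.ext (hπ i).1.map_eq
  have e2 : ∀ i, (π i).map measurable_snd.aemeasurable = u i := fun i =>
    Subtype.ext (hπ i).2.map_eq
  simp only [e1] at h1
  simp only [e2] at h2
  have f1 := tendsto_nhds_unique h1 tendsto_const_nhds
  have f2 := tendsto_nhds_unique h2 hu
  have hσ' : σ ∈ couplings P Q :=
    ⟨⟨measurable_fst.aemeasurable, congrArg Subtype.val f1⟩,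
      ⟨measurable_snd.aemeasurable, congrArg Subtype.val f2⟩⟩
  refine (SimplexLaw.distW_le_coupling hσ').trans (le_of_tendsto hcost ?_)
  filter_upwards [hr] with i hi
  exact (hc i).trans_le hi

/-- The Cauchy bound on the distance from `u n` to later terms passes to a weak ultrafilter limit,
so convergence of the whole sequence in the metric follows. -/
theorem SimplexLaw.completeSpace : CompleteSpace (SimplexLaw d) := by
  refine Metric.complete_of_cauchySeq_tendsto fun u hu => ?_
  let F : Ultrafilter ℕ := hyperfilter ℕ
  let v : ℕ → ProbabilityMeasure (scaledSimplex d) := u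
  obtain ⟨Q, -, hQ⟩ := isCompact_univ.ultrafilter_le_nhds (F.map v) (by simp)
  refine ⟨Q, Metric.tendsto_atTop.2 fun ε hε => ?_⟩
  obtain ⟨N, hN⟩ := Metric.cauchySeq_iff.1 hu (ε / 2) (half_pos hε)
  refine ⟨N, fun n hn => lt_of_le_of_lt ?_ (half_lt_self hε)⟩
  refine SimplexLaw.distW_le_of_tendsto (F := F) (u := v) hQ (u n) ?_
  have : ∀ᶠ m in atTop, N ≤ m := eventually_ge_atTop N
  filter_upwards [this.filter_mono Nat.hyperfilter_le_atTop] with m hm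
  exact (hN n hn m hm).le

/-- Every law on `S_d` is the law of an integrable random vector on the unit interval. -/
theorem SimplexLaw.exists_hasLaw_unitInterval (P : SimplexLaw d) :
    ∃ X : unitInterval → scaledSimplex d, HasLaw X P.toMeasure volume ∧
      Integrable (fun t => (X t : Fin d → ℝ)) := by
  have := P.nonempty
  obtain ⟨X, hX, h⟩ := P.toMeasure.exists_measurable_map_eq
  refine ⟨X, ⟨hX.aemeasurable, h⟩, ?_⟩
  exact .of_bound (hX.subtype_val.aestronglyMeasurable) d
    (ae_of_all _ fun t => norm_le_of_mem_scaledSimplex (X t).2)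

/-- The range is separable, and the inverse from it onto the domain is Lipschitz. -/
theorem AntilipschitzWith.separableSpace {α β : Type*} [PseudoMetricSpace α] [PseudoMetricSpace β]
    [SecondCountableTopology β] {K : NNReal} {f : α → β} (hf : AntilipschitzWith K f)
    (hinj : Function.Injective f) : TopologicalSpace.SeparableSpace α := by
  have hl : Function.LeftInverse (Equiv.ofInjective f hinj).symm (Set.rangeFactorization f) :=
    fun a => (Equiv.ofInjective f hinj).symm_apply_apply a
  have hL : LipschitzWith K (Equiv.ofInjective f hinj).symm := by
    refine (show AntilipschitzWith K (Equiv.ofInjective f hinj) from hf).to_rightInverse ?_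
    exact (Equiv.ofInjective f hinj).apply_symm_apply
  exact hl.surjective.denseRange.separableSpace hL.continuous

theorem SimplexLaw.separableSpace : TopologicalSpace.SeparableSpace (SimplexLaw d) := by
  choose X hX hint using fun P : SimplexLaw d => P.exists_hasLaw_unitInterval
  let Φ : SimplexLaw d → Lp (Fin d → ℝ) 1 (volume : Measure unitInterval) := fun P =>
    (hint P).toL1
  have hΦ : AntilipschitzWith d Φ := by
    refine AntilipschitzWith.of_le_mul_dist fun P Q => ?_
    -- The two representatives live on the same interval and so form an admissible pair; the factor
    -- `d` compares the ℓ¹-norm with the sup-norm.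
    refine (SimplexLaw.distW_le (hX P) (hX Q)).trans ?_
    rw [dist_eq_norm, ← Integrable.toL1_sub, L1.norm_of_fun_eq_integral_norm]
    simp only [NNReal.coe_natCast]
    rw [← integral_const_mul]
    refine integral_mono_of_nonneg (ae_of_all _ fun _ => l1Norm_nonneg _)
      (((hint P).sub (hint Q)).norm.const_mul _) (ae_of_all _ fun t => ?_)
    exact l1Norm_le_card_mul_norm _
  have : Fact ((1 : ENNReal) ≠ ⊤) := ⟨ENNReal.one_ne_top⟩
  exact hΦ.separableSpace hΦ.injective

theorem SimplexLaw.abs_integral_coord_sub_le (P Q : SimplexLaw d) (i : Fin d) :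
    |∫ z, (z : Fin d → ℝ) i ∂P.toMeasure - ∫ z, (z : Fin d → ℝ) i ∂Q.toMeasure| ≤ P.distW Q := by
  obtain ⟨π, hπ, h⟩ := exists_optimal_coupling P Q
  have hc : Continuous fun z : scaledSimplex d => (z : Fin d → ℝ) i :=
    (continuous_apply i).comp continuous_subtype_val
  have hi : ∀ (μ : Measure (scaledSimplex d)) [IsFiniteMeasure μ],
      Integrable (fun z : scaledSimplex d => (z : Fin d → ℝ) i) μ := fun μ _ =>
    (BoundedContinuousFunction.mkOfCompact ⟨_, hc⟩).integrable μ
  have i₁ : Integrable (fun p : scaledSimplex d × scaledSimplex d => (p.1 : Fin d → ℝ) i)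
      π.toMeasure :=
    (hi _).comp_aemeasurable hπ.1.aemeasurable
  have i₂ : Integrable (fun p : scaledSimplex d × scaledSimplex d => (p.2 : Fin d → ℝ) i)
      π.toMeasure :=
    (hi _).comp_aemeasurable hπ.2.aemeasurable
  rw [← hπ.1.integral_comp hc.aestronglyMeasurable, ← hπ.2.integral_comp hc.aestronglyMeasurable,
    ← h]
  simp only [Function.comp_def]
  rw [← integral_sub i₁ i₂]
  refine (abs_integral_le_integral_abs).trans
    (integral_mono_of_nonneg (ae_of_all _ fun _ => abs_nonneg _) (integrable_l1Cost _)
      (ae_of_all _ fun p => abs_le_l1Norm ((p.1 : Fin d → ℝ) - (p.2 : Fin d → ℝ)) i))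

theorem isClosed_meanOneLaws : IsClosed (meanOneLaws d) := by
  have h : ∀ i, Continuous fun P : SimplexLaw d => ∫ z, (z : Fin d → ℝ) i ∂P.toMeasure := fun i =>
    (LipschitzWith.of_dist_le_mul (K := 1) fun P Q => by
      simpa [Real.dist_eq, SimplexLaw.dist_def] using P.abs_integral_coord_sub_le Q i).continuous
  simp only [meanOneLaws, Set.ofPred_forall]
  exact isClosed_iInter fun i => isClosed_eq (h i) continuous_const

end Coupling

/-! ### Normalized generators and their laws -/

section Generators

variable {d : ℕ}

theorem one_mem_scaledSimplex : (1 : Fin d → ℝ) ∈ scaledSimplex d :=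
  ⟨fun _ => zero_le_one, by simp [l1Norm]⟩

theorem sum_eq_of_mem_scaledSimplex {x : Fin d → ℝ} (hx : x ∈ scaledSimplex d) :
    ∑ i, x i = d := by
  rw [← hx.2]
  exact Finset.sum_congr rfl fun i _ => (abs_of_nonneg (hx.1 i)).symm

theorem continuous_coord (i : Fin d) : Continuous fun z : scaledSimplex d => (z : Fin d → ℝ) i :=
  (continuous_apply i).comp continuous_subtype_val

theorem integrable_of_continuous {f : scaledSimplex d → ℝ} (hf : Continuous f)
    (P : Measure (scaledSimplex d)) [IsFiniteMeasure P] : Integrable f P :=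
  (BoundedContinuousFunction.mkOfCompact ⟨f, hf⟩).integrable P

theorem continuous_norm_mul (x : Fin d → ℝ) :
    Continuous fun z : scaledSimplex d => ‖x * (z : Fin d → ℝ)‖ := by
  fun_prop

theorem exists_ae_eq_subtype_val {Ω : Type*} [MeasurableSpace Ω] {μ : Measure Ω}
    {Z : Ω → Fin d → ℝ} (hZ : AEMeasurable Z μ) (h : ∀ᵐ ω ∂μ, Z ω ∈ scaledSimplex d) :
    ∃ X : Ω → scaledSimplex d, Measurable X ∧ Z =ᵐ[μ] fun ω => (X ω : Fin d → ℝ) := by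
  obtain ⟨g, hg, hgs, hgZ⟩ := hZ.exists_ae_eq_range_subset h ⟨1, one_mem_scaledSimplex⟩
  exact ⟨fun ω => ⟨g ω, hgs ⟨ω, rfl⟩⟩, hg.subtype_mk, hgZ⟩

theorem isNormalizedGenerator_subtype_val {P : SimplexLaw d} (hP : P ∈ meanOneLaws d)
    {N : (Fin d → ℝ) → ℝ} (hN : ∀ x, N x = ∫ z, ‖x * (z : Fin d → ℝ)‖ ∂P.toMeasure) :
    IsNormalizedGenerator P.toMeasure Subtype.val N where
  left :=
    { aemeasurable := measurable_subtype_coe.aemeasurable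
      nonneg := ae_of_all _ fun z => z.2.1
      integrable := fun i => integrable_of_continuous (continuous_coord i) _
      mean_one := hP
      eq_integral := hN }
  right := ae_of_all _ fun z => z.2.2

/-- The law on `S_d` of a normalized generator. -/
theorem IsNormalizedGenerator.exists_law {Ω : Type*} [MeasurableSpace Ω] {μ : Measure Ω}
    [IsProbabilityMeasure μ] {Z : Ω → Fin d → ℝ} {N : (Fin d → ℝ) → ℝ}
    (hZ : IsNormalizedGenerator μ Z N) :
    ∃ P ∈ meanOneLaws d, (∀ x, N x = ∫ z, ‖x * (z : Fin d → ℝ)‖ ∂P.toMeasure) ∧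
      ∃ X : Ω → scaledSimplex d, HasLaw X P.toMeasure μ ∧
        Z =ᵐ[μ] fun ω => (X ω : Fin d → ℝ) := by
  obtain ⟨X, hX, hXZ⟩ := exists_ae_eq_subtype_val hZ.1.aemeasurable
    (hZ.1.nonneg.and hZ.2)
  let P : SimplexLaw d := ⟨μ.map X, Measure.isProbabilityMeasure_map hX.aemeasurable⟩
  have hl : HasLaw X P.toMeasure μ := ⟨hX.aemeasurable, rfl⟩
  refine ⟨P, fun i => ?_, fun x => ?_, X, hl, hXZ⟩
  · rw [← hl.integral_comp (continuous_coord i).aestronglyMeasurable, ← hZ.1.mean_one i]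
    refine integral_congr_ae ?_
    filter_upwards [hXZ] with ω h
    simp [h]
  · rw [← hl.integral_comp (continuous_norm_mul x).aestronglyMeasurable, hZ.1.eq_integral x]
    refine integral_congr_ae ?_
    filter_upwards [hXZ] with ω h
    simp [h]

/-- Every generator can be normalized by a change of measure. -/
theorem IsGenerator.exists_normalized (hd : 1 ≤ d) {Ω : Type*} [MeasurableSpace Ω] {μ : Measure Ω}
    {Z : Ω → Fin d → ℝ} {N : (Fin d → ℝ) → ℝ} (hZ : IsGenerator μ Z N) :
    ∃ (ρ : Measure Ω) (_ : IsProbabilityMeasure ρ) (T : Ω → Fin d → ℝ),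
      IsNormalizedGenerator ρ T N := by
  obtain ⟨G, hG, hG0, hGe⟩ := hZ.aemeasurable.exists_measurable_nonneg hZ.nonneg
  have hd0 : (0 : ℝ) < d := Nat.cast_pos.2 hd
  have hGi : ∀ i, Measurable fun ω => G ω i := fun i => (measurable_pi_apply i).comp hG
  have hGint : ∀ i, Integrable (fun ω => G ω i) μ := fun i =>
    (hZ.integrable i).congr (hGe.mono fun ω h => by simp [h])
  have hGone : ∀ i, ∫ ω, G ω i ∂μ = 1 := fun i => by
    rw [← hZ.mean_one i]
    exact integral_congr_ae (hGe.mono fun ω h => by simp [h])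
  let s : Ω → ℝ := fun ω => ∑ i, G ω i
  have hs : Measurable s := Finset.measurable_sum _ fun i _ => hGi i
  have hs0 : ∀ ω, 0 ≤ s ω := fun ω => Finset.sum_nonneg fun i _ => hG0 ω i
  let w : Ω → NNReal := fun ω => (s ω / d).toNNReal
  have hw : Measurable w := (hs.div_const _).real_toNNReal
  have hwc : ∀ ω, (w ω : ℝ) = s ω / d := fun ω =>
    Real.coe_toNNReal _ (div_nonneg (hs0 ω) hd0.le)
  -- The value `1` where `G` vanishes is an arbitrary point of the simplex; the density `w` is zero
  -- there.
  let T : Ω → Fin d → ℝ := fun ω => if s ω = 0 then 1 else (d / s ω) • G ω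
  have hT : Measurable T := by
    refine Measurable.ite (measurableSet_eq_fun hs measurable_const) measurable_const ?_
    exact (measurable_const.div hs).smul hG
  have hTmem : ∀ ω, T ω ∈ scaledSimplex d := by
    intro ω
    by_cases h : s ω = 0
    · simp only [T, h, if_true]
      exact one_mem_scaledSimplex
    · simp only [T, h, if_false]
      have hnn : ∀ i, 0 ≤ (d / s ω) * G ω i := fun i =>
        mul_nonneg (div_nonneg hd0.le (hs0 ω)) (hG0 ω i)
      refine ⟨hnn, ?_⟩
      simp only [l1Norm, Pi.smul_apply, smul_eq_mul, abs_of_nonneg (hnn _), ← Finset.mul_sum]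
      exact div_mul_cancel₀ _ h
  have hTG : ∀ ω, (w ω : ℝ) • T ω = G ω := by
    intro ω
    rw [hwc]
    by_cases h : s ω = 0
    · have h0 : G ω = 0 := funext fun i =>
        (Finset.sum_eq_zero_iff_of_nonneg fun i _ => hG0 ω i).1 h i (Finset.mem_univ i)
      simp [h, h0]
    · simp only [T, h, if_false, smul_smul]
      rw [div_mul_div_cancel₀ hd0.ne', div_self h, one_smul]
  let ρ : Measure Ω := μ.withDensity fun ω => w ω
  have hρ : IsProbabilityMeasure ρ := by
    refine ⟨?_⟩
    have hsint : Integrable (fun ω => s ω / d) μ :=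
      (integrable_finsetSum _ fun i _ => hGint i).div_const _
    have h1 : ∫ ω, s ω / d ∂μ = 1 := by
      rw [integral_div, integral_finsetSum _ fun i _ => hGint i]
      simp [hGone, hd0.ne']
    rw [withDensity_apply _ MeasurableSet.univ, setLIntegral_univ]
    exact (ofReal_integral_eq_lintegral_ofReal hsint
      (ae_of_all _ fun ω => div_nonneg (hs0 ω) hd0.le)).symm.trans (by simp [h1])
  refine ⟨ρ, hρ, T, ⟨hT.aemeasurable, ae_of_all _ fun ω => (hTmem ω).1, fun i => ?_, fun i => ?_,
    fun x => ?_⟩, ae_of_all _ fun ω => (hTmem ω).2⟩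
  · refine .of_bound ((measurable_pi_apply i).comp hT).aestronglyMeasurable d
      (ae_of_all _ fun ω => ?_)
    exact (norm_le_pi_norm (T ω) i).trans (norm_le_of_mem_scaledSimplex (hTmem ω))
  · rw [integral_withDensity_eq_integral_smul hw, ← hGone i]
    exact integral_congr_ae (ae_of_all _ fun ω => congrFun (hTG ω) i)
  · rw [integral_withDensity_eq_integral_smul hw, hZ.eq_integral x]
    refine integral_congr_ae (hGe.mono fun ω h => ?_)
    simp only
    rw [h, ← hTG ω, mul_smul_comm, norm_smul, Real.norm_of_nonneg (w ω).coe_nonneg]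
    rfl

end Generators

/-! ### The D-norm determines the law -/

section Uniqueness

variable {d : ℕ}

/-- The functional `t ↦ max(t zₖ, M)` that occurs in the `D`-norm along the `k`-th coordinate. -/
theorem norm_update_mul {k : Fin d} {c z : Fin d → ℝ} (hz : ∀ i, 0 ≤ z i) {t : ℝ} (ht : 0 ≤ t) :
    ‖Function.update c k t * z‖ = max (t * z k) ‖Function.update c k 0 * z‖ := by
  have h0 : 0 ≤ t * z k := mul_nonneg ht (hz k)
  apply le_antisymm
  · refine (pi_norm_le_iff_of_nonneg (le_max_of_le_left h0)).2 fun i => ?_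
    by_cases hi : i = k
    · subst hi
      simp [abs_of_nonneg ht, abs_of_nonneg (hz i)]
    · refine le_max_of_le_right ?_
      have := norm_le_pi_norm (Function.update c k 0 * z) i
      simpa [hi] using this
  · refine max_le ?_ ((pi_norm_le_iff_of_nonneg (norm_nonneg _)).2 fun i => ?_)
    · have := norm_le_pi_norm (Function.update c k t * z) k
      simpa [abs_of_nonneg ht, abs_of_nonneg (hz k)] using this
    · by_cases hi : i = k
      · subst hi; simp
      · have := norm_le_pi_norm (Function.update c k t * z) i
        simpa [hi] using this

/-- The quotient is eventually constant. Approaching from the left makes it vanish in the tie `a =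
M`, which yields the strict inequality. -/
theorem tendsto_left_quotient_max {a M : ℝ} (ha : 0 ≤ a) :
    Tendsto (fun n : ℕ => ((n : ℝ) + 1) * (max (1 * a) M - max ((1 - 1 / ((n : ℝ) + 1)) * a) M))
      atTop (𝓝 (if M < a then a else 0)) := by
  have ht : Tendsto (fun n : ℕ => (1 - 1 / ((n : ℝ) + 1)) * a) atTop (𝓝 a) := by
    simpa using ((tendsto_const_nhds (x := (1 : ℝ))).sub tendsto_one_div_add_atTop_nhds_zero_nat).mul_const a
  refine tendsto_const_nhds.congr' ?_
  split_ifs with h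
  · filter_upwards [ht.eventually_const_lt h] with n hn
    rw [max_eq_left (by linarith), max_eq_left hn.le]
    field_simp
    ring
  · refine Eventually.of_forall fun n => ?_
    have hle : (1 - 1 / ((n : ℝ) + 1)) * a ≤ a := by
      have : 0 ≤ 1 / ((n : ℝ) + 1) * a := mul_nonneg (by positivity) ha
      linarith
    have haM : a ≤ M := not_lt.1 h
    simp only [one_mul, max_eq_right haM, max_eq_right (hle.trans haM), sub_self, mul_zero]

/-- The left derivative of `t ↦ E max(t Zₖ, M)` at `t = 1`. -/
theorem tendsto_left_quotient_integral (P : Measure (scaledSimplex d)) [IsFiniteMeasure P]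
    (k : Fin d) (c : Fin d → ℝ) :
    Tendsto (fun n : ℕ => ((n : ℝ) + 1) *
      (∫ z, ‖Function.update c k 1 * (z : Fin d → ℝ)‖ ∂P -
        ∫ z, ‖Function.update c k (1 - 1 / ((n : ℝ) + 1)) * (z : Fin d → ℝ)‖ ∂P)) atTop
      (𝓝 (∫ z, {z : scaledSimplex d | ‖Function.update c k 0 * (z : Fin d → ℝ)‖ <
        (z : Fin d → ℝ) k}.indicator (fun z => (z : Fin d → ℝ) k) z ∂P)) := by
  have ht : ∀ n : ℕ, 0 ≤ 1 - 1 / ((n : ℝ) + 1) := fun n => by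
    rw [sub_nonneg, div_le_one (by positivity)]
    linarith [(Nat.cast_nonneg n : (0 : ℝ) ≤ n)]
  have hrw : ∀ n : ℕ, ((n : ℝ) + 1) *
      (∫ z, ‖Function.update c k 1 * (z : Fin d → ℝ)‖ ∂P -
        ∫ z, ‖Function.update c k (1 - 1 / ((n : ℝ) + 1)) * (z : Fin d → ℝ)‖ ∂P) =
      ∫ z, ((n : ℝ) + 1) * (‖Function.update c k 1 * (z : Fin d → ℝ)‖ -
        ‖Function.update c k (1 - 1 / ((n : ℝ) + 1)) * (z : Fin d → ℝ)‖) ∂P := fun n => by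
    rw [integral_const_mul, integral_sub (integrable_of_continuous (continuous_norm_mul _) P)
      (integrable_of_continuous (continuous_norm_mul _) P)]
  simp only [hrw]
  -- Since `max` is 1-Lipschitz, each quotient is at most z_k, hence at most `d`.
  refine tendsto_integral_of_dominated_convergence (fun _ => (d : ℝ))
    (fun n => ?_) (integrable_const _) (fun n => ae_of_all _ fun z => ?_)
    (ae_of_all _ fun z => ?_)
  · exact (continuous_const.mul ((continuous_norm_mul _).sub
      (continuous_norm_mul _))).aestronglyMeasurable
  · rw [norm_update_mul z.2.1 zero_le_one, norm_update_mul z.2.1 (ht n), norm_mul,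
      Real.norm_eq_abs, Real.norm_eq_abs, abs_of_nonneg (by positivity)]
    have h1 := abs_max_sub_max_le_abs (1 * (z : Fin d → ℝ) k)
      ((1 - 1 / ((n : ℝ) + 1)) * (z : Fin d → ℝ) k) ‖Function.update c k 0 * (z : Fin d → ℝ)‖
    have h2 : 1 * (z : Fin d → ℝ) k - (1 - 1 / ((n : ℝ) + 1)) * (z : Fin d → ℝ) k =
      (z : Fin d → ℝ) k / ((n : ℝ) + 1) := by ring
    rw [h2, abs_of_nonneg (div_nonneg (z.2.1 k) (by positivity)),
      le_div_iff₀ (by positivity), mul_comm] at h1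
    refine h1.trans ((le_abs_self _).trans ?_)
    exact (norm_le_pi_norm _ k).trans (norm_le_of_mem_scaledSimplex z.2)
  · simp only [norm_update_mul z.2.1 (ht _), norm_update_mul z.2.1 zero_le_one,
      Set.indicator_apply, Set.mem_ofPred_eq]
    exact tendsto_left_quotient_max (z.2.1 k)

/-- The measure `zₖ P(dz)`. -/
def coordDensity (P : Measure (scaledSimplex d)) (k : Fin d) : Measure (scaledSimplex d) :=
  P.withDensity fun z => ENNReal.ofReal ((z : Fin d → ℝ) k)

instance (P : Measure (scaledSimplex d)) [IsFiniteMeasure P] (k : Fin d) :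
    IsFiniteMeasure (coordDensity P k) :=
  isFiniteMeasure_withDensity_ofReal (integrable_of_continuous (continuous_coord k) P).2

theorem coordDensity_apply (P : Measure (scaledSimplex d)) [IsFiniteMeasure P] (k : Fin d)
    {A : Set (scaledSimplex d)} (hA : MeasurableSet A) :
    coordDensity P k A =
      ENNReal.ofReal (∫ z, A.indicator (fun z => (z : Fin d → ℝ) k) z ∂P) := by
  rw [integral_indicator hA, coordDensity, withDensity_apply _ hA,
    ofReal_integral_eq_lintegral_ofReal (integrable_of_continuous (continuous_coord k) _)
      (ae_of_all _ fun z => z.2.1 k)]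

theorem ae_coordDensity_pos (P : Measure (scaledSimplex d)) (k : Fin d) :
    ∀ᵐ z : scaledSimplex d ∂coordDensity P k, 0 < (z : Fin d → ℝ) k := by
  rw [coordDensity, ae_withDensity_iff (continuous_coord k).measurable.ennreal_ofReal]
  exact ae_of_all _ fun z hz => ENNReal.ofReal_pos.1 (pos_iff_ne_zero.2 hz)

variable {P Q : Measure (scaledSimplex d)} [IsFiniteMeasure P] [IsFiniteMeasure Q]

theorem coordDensity_box_eq
    (h : ∀ x : Fin d → ℝ, ∫ z, ‖x * (z : Fin d → ℝ)‖ ∂P = ∫ z, ‖x * (z : Fin d → ℝ)‖ ∂Q)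
    (k : Fin d) (c : Fin d → ℝ) :
    coordDensity P k {z : scaledSimplex d | ‖Function.update c k 0 * (z : Fin d → ℝ)‖ < (z : Fin d → ℝ) k} =
      coordDensity Q k
        {z : scaledSimplex d | ‖Function.update c k 0 * (z : Fin d → ℝ)‖ < (z : Fin d → ℝ) k} := by
  have hm : MeasurableSet {z : scaledSimplex d |
      ‖Function.update c k 0 * (z : Fin d → ℝ)‖ < (z : Fin d → ℝ) k} :=
    (isOpen_lt (continuous_norm_mul _) (continuous_coord k)).measurableSet
  rw [coordDensity_apply P k hm, coordDensity_apply Q k hm]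
  congr 1
  have hP := tendsto_left_quotient_integral P k c
  simp only [h] at hP
  exact tendsto_nhds_unique hP (tendsto_left_quotient_integral Q k c)

/-- The projective coordinates `zᵢ / zₖ`. -/
def coordRatio (k : Fin d) (z : scaledSimplex d) : Fin d → ℝ :=
  fun i => (z : Fin d → ℝ) i / (z : Fin d → ℝ) k

theorem measurable_coordRatio (k : Fin d) : Measurable (coordRatio k) :=
  measurable_pi_lambda _ fun i =>
    (continuous_coord i).measurable.div (continuous_coord k).measurable

/-- Where z_k > 0, the conditions z_i/z_k < c_i with i ≠ k say that max z_i/c_i < z_k, while i = k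
demands 1 < c_k. Ratios are nonnegative, so other choices of `c` give null sets. -/
theorem coordDensity_preimage_box (P : Measure (scaledSimplex d)) (k : Fin d) (c : Fin d → ℝ) :
    coordDensity P k (coordRatio k ⁻¹' Set.univ.pi fun i => Set.Iio (c i)) =
      if (∀ i, 0 < c i) ∧ 1 < c k then
        coordDensity P k {z : scaledSimplex d | ‖Function.update c⁻¹ k 0 * (z : Fin d → ℝ)‖ < (z : Fin d → ℝ) k}
      else 0 := by
  split_ifs with hc
  · refine measure_congr ?_
    filter_upwards [ae_coordDensity_pos P k] with z hz
    refine propext ?_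
    change (∀ i ∈ Set.univ, coordRatio k z i < c i) ↔
      ‖Function.update c⁻¹ k 0 * (z : Fin d → ℝ)‖ < (z : Fin d → ℝ) k
    rw [pi_norm_lt_iff hz]
    refine ⟨fun h i => ?_, fun h i _ => ?_⟩
    · by_cases hi : i = k
      · subst hi; simpa using hz
      · have := h i trivial
        rw [coordRatio, div_lt_iff₀ hz] at this
        simp only [Pi.mul_apply, Function.update_of_ne hi, Pi.inv_apply]
        rw [Real.norm_of_nonneg (mul_nonneg (inv_nonneg.2 (hc.1 i).le) (z.2.1 i)),
          inv_mul_lt_iff₀ (hc.1 i)]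
        exact this
    · by_cases hi : i = k
      · subst hi
        rw [coordRatio, div_self hz.ne']
        exact hc.2
      · have := h i
        simp only [Pi.mul_apply, Function.update_of_ne hi, Pi.inv_apply] at this
        rw [Real.norm_of_nonneg (mul_nonneg (inv_nonneg.2 (hc.1 i).le) (z.2.1 i)),
          inv_mul_lt_iff₀ (hc.1 i)] at this
        rwa [coordRatio, div_lt_iff₀ hz]
  · rw [← nonpos_iff_eq_zero, ← measure_empty (μ := coordDensity P k)]
    refine measure_mono_ae ?_
    filter_upwards [ae_coordDensity_pos P k] with z hz hzc
    have hlt : ∀ i, coordRatio k z i < c i := fun i => hzc i trivial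
    refine hc ⟨fun i => (div_nonneg (z.2.1 i) hz.le).trans_lt (hlt i), ?_⟩
    have := hlt k
    rwa [coordRatio, div_self hz.ne'] at this

theorem map_coordRatio_eq
    (h : ∀ x : Fin d → ℝ, ∫ z, ‖x * (z : Fin d → ℝ)‖ ∂P = ∫ z, ‖x * (z : Fin d → ℝ)‖ ∂Q)
    (k : Fin d) :
    (coordDensity P k).map (coordRatio k) = (coordDensity Q k).map (coordRatio k) := by
  have hm := measurable_coordRatio (d := d) k
  have hspan : IsCountablySpanning (Set.range (Set.Iio : ℝ → Set ℝ)) := by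
    refine ⟨fun n : ℕ => Set.Iio (n : ℝ), fun n => ⟨_, rfl⟩, ?_⟩
    exact Set.eq_univ_of_forall fun x => Set.mem_iUnion.2 (exists_nat_gt x)
  have hgen := generateFrom_eq_pi (ι := Fin d) (α := fun _ => ℝ)
    (C := fun _ => Set.range Set.Iio)
    (fun _ => (borel_eq_generateFrom_Iio ℝ).symm.trans (BorelSpace.measurable_eq).symm)
    (fun _ => hspan)
  refine ext_of_generate_finite _ hgen.symm (IsPiSystem.pi fun _ => isPiSystem_Iio) ?_ ?_
  · rintro _ ⟨s, hs, rfl⟩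
    choose c hc using fun i => hs i trivial
    obtain rfl : (fun i => Set.Iio (c i)) = s := funext hc
    have hbox : MeasurableSet (Set.univ.pi fun i => Set.Iio (c i)) :=
      MeasurableSet.univ_pi fun i => measurableSet_Iio
    rw [Measure.map_apply hm hbox, Measure.map_apply hm hbox, coordDensity_preimage_box,
      coordDensity_preimage_box, coordDensity_box_eq h]
  · rw [Measure.map_apply hm .univ, Measure.map_apply hm .univ, Set.preimage_univ,
      coordDensity_apply P k .univ, coordDensity_apply Q k .univ]
    -- The total mass is the norm of the `k`-th unit vector.
    have hk : ∀ z : scaledSimplex d,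
        (z : Fin d → ℝ) k = ‖Function.update (0 : Fin d → ℝ) k 1 * (z : Fin d → ℝ)‖ := fun z => by
      rw [norm_update_mul z.2.1 zero_le_one]
      simp [z.2.1 k]
    simp only [Set.indicator_univ, hk, h]

theorem coordDensity_eq
    (h : ∀ x : Fin d → ℝ, ∫ z, ‖x * (z : Fin d → ℝ)‖ ∂P = ∫ z, ‖x * (z : Fin d → ℝ)‖ ∂Q)
    (k : Fin d) : coordDensity P k = coordDensity Q k := by
  -- This undoes the passage to ratios: they sum to d/z_k, so the rescaling factor is z_k.
  let S : (Fin d → ℝ) → Fin d → ℝ := fun w => (d / ∑ i, w i) • w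
  have hS : Measurable S := by fun_prop
  have hrec : ∀ R : Measure (scaledSimplex d),
      (coordDensity R k).map Subtype.val = ((coordDensity R k).map (coordRatio k)).map S := by
    intro R
    rw [Measure.map_map hS (measurable_coordRatio k)]
    refine Measure.map_congr ?_
    filter_upwards [ae_coordDensity_pos R k] with z hz
    have hd : (d : ℝ) ≠ 0 := Nat.cast_ne_zero.2 k.pos.ne'
    have hsum : ∑ i, coordRatio k z i = d / (z : Fin d → ℝ) k := by
      simp only [coordRatio, ← Finset.sum_div, sum_eq_of_mem_scaledSimplex z.2]
    funext i
    simp only [Function.comp_apply, S, hsum, Pi.smul_apply, smul_eq_mul]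
    simp only [coordRatio]
    field_simp
  ext B hB
  obtain ⟨B', hB', rfl⟩ := hB
  rw [← Measure.map_apply measurable_subtype_coe hB', ← Measure.map_apply measurable_subtype_coe hB',
    hrec, hrec, map_coordRatio_eq h]

/-- A finite measure on `S_d` is determined by its `D`-norm. -/
theorem measure_eq_of_integral_norm_mul_eq (hd : 1 ≤ d)
    (h : ∀ x : Fin d → ℝ, ∫ z, ‖x * (z : Fin d → ℝ)‖ ∂P = ∫ z, ‖x * (z : Fin d → ℝ)‖ ∂Q) :
    P = Q := by
  -- The coordinates sum to `d` on the simplex, so the measures z_k R(dz) add up to d·R.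
  have hsum : ∀ (R : Measure (scaledSimplex d)) {B : Set (scaledSimplex d)}, MeasurableSet B →
      ∑ k, coordDensity R k B = d * R B := by
    intro R B hB
    simp only [coordDensity, withDensity_apply _ hB]
    rw [← lintegral_finsetSum _ fun k _ => (continuous_coord k).measurable.ennreal_ofReal]
    have : ∀ z : scaledSimplex d, ∑ k, ENNReal.ofReal ((z : Fin d → ℝ) k) = d := fun z => by
      rw [← ENNReal.ofReal_sum_of_nonneg fun k _ => z.2.1 k, sum_eq_of_mem_scaledSimplex z.2]
      simp
    simp [this]
  ext B hB
  have h2 := hsum P hB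
  simp only [coordDensity_eq h] at h2
  rw [hsum Q hB] at h2
  exact ((ENNReal.mul_right_inj (by simpa using Nat.pos_iff_ne_zero.1 hd)
    (ENNReal.natCast_ne_top d)).1 h2).symm

end Uniqueness

/-! ### The isometry between D-norms and laws -/

section DNormLaw

variable {d : ℕ}

/-- The `D`-norm generated by a law on `S_d` with means one. -/
def DNorm.ofLaw (P : SimplexLaw d) (hP : P ∈ meanOneLaws d) : DNorm d :=
  ⟨Seminorm.of (fun x => ∫ z, ‖x * (z : Fin d → ℝ)‖ ∂P.toMeasure)
    (fun x y => by
      rw [← integral_add (integrable_of_continuous (continuous_norm_mul x) _)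
        (integrable_of_continuous (continuous_norm_mul y) _)]
      refine integral_mono (integrable_of_continuous (continuous_norm_mul _) _)
        ((integrable_of_continuous (continuous_norm_mul x) _).add
        (integrable_of_continuous (continuous_norm_mul y) _)) fun z => ?_
      simp only [add_mul]
      exact norm_add_le _ _)
    (fun a x => by simp only [smul_mul_assoc, norm_smul, integral_const_mul]),
    fun x hx => by
      change ∫ z, ‖x * (z : Fin d → ℝ)‖ ∂P.toMeasure = 0 at hx
      rw [integral_eq_zero_iff_of_nonneg (fun _ => norm_nonneg _)
        (integrable_of_continuous (continuous_norm_mul x) _)] at hx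
      funext i
      -- Definiteness comes from the means: if x z = 0 almost surely, then 0 = E(x_i z_i) = x_i.
      have h1 : ∫ z, x i * (z : Fin d → ℝ) i ∂P.toMeasure = 0 :=
        integral_eq_zero_of_ae (hx.mono fun z hz => congrFun (norm_eq_zero.1 hz) i)
      rwa [integral_const_mul, hP i, mul_one] at h1,
    scaledSimplex d, inferInstance, P.toMeasure, inferInstance, Subtype.val,
    (isNormalizedGenerator_subtype_val hP fun _ => rfl).1⟩

theorem DNorm.toFun_injective : Function.Injective (DNorm.toFun : DNorm d → _) :=
  fun _ _ h => Subtype.ext (DFunLike.coe_injective h)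

theorem DNorm.exists_law (hd : 1 ≤ d) (D : DNorm d) :
    ∃ P : meanOneLaws d, ∀ x, D.toFun x = ∫ z, ‖x * (z : Fin d → ℝ)‖ ∂P.1.toMeasure := by
  obtain ⟨Ω, _, μ, _, Z, hZ⟩ := D.2.2
  obtain ⟨ρ, _, T, hT⟩ := hZ.exists_normalized hd
  obtain ⟨P, hP, h, -⟩ := hT.exists_law
  exact ⟨⟨P, hP⟩, h⟩

/-- The law of the normalized generators of a `D`-norm. -/
def DNorm.law (hd : 1 ≤ d) (D : DNorm d) : meanOneLaws d := (D.exists_law hd).choose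

theorem DNorm.toFun_eq (hd : 1 ≤ d) (D : DNorm d) (x : Fin d → ℝ) :
    D.toFun x = ∫ z, ‖x * (z : Fin d → ℝ)‖ ∂(D.law hd).1.toMeasure :=
  (D.exists_law hd).choose_spec x

theorem DNorm.eq_law (hd : 1 ≤ d) (D : DNorm d) {P : SimplexLaw d}
    (hP : ∀ x, D.toFun x = ∫ z, ‖x * (z : Fin d → ℝ)‖ ∂P.toMeasure) : P = (D.law hd).1 :=
  SimplexLaw.toMeasure_injective <| measure_eq_of_integral_norm_mul_eq hd fun x =>
    (hP x).symm.trans (D.toFun_eq hd x)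

theorem DNorm.law_bijective (hd : 1 ≤ d) : Function.Bijective (DNorm.law (d := d) hd) := by
  refine ⟨fun D₁ D₂ h => DNorm.toFun_injective (funext fun x => ?_), fun P => ?_⟩
  · rw [D₁.toFun_eq hd, D₂.toFun_eq hd, h]
  · exact ⟨DNorm.ofLaw P.1 P.2, Subtype.ext (DNorm.eq_law hd _ fun _ => rfl).symm⟩

theorem DNorm.exists_hasLaw (hd : 1 ≤ d) {D : DNorm d} {Ω : Type*} [MeasurableSpace Ω]
    {μ : Measure Ω} [IsProbabilityMeasure μ] {Z : Ω → Fin d → ℝ}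
    (hZ : IsNormalizedGenerator μ Z D.toFun) :
    ∃ X : Ω → scaledSimplex d, HasLaw X (D.law hd).1.toMeasure μ ∧
      Z =ᵐ[μ] fun ω => (X ω : Fin d → ℝ) := by
  obtain ⟨P, -, h, X, hX, hXZ⟩ := hZ.exists_law
  exact ⟨X, D.eq_law hd h ▸ hX, hXZ⟩

theorem isNormalizedGenerator_of_hasLaw {P : SimplexLaw d} {N : (Fin d → ℝ) → ℝ}
    (hP : IsNormalizedGenerator P.toMeasure Subtype.val N) {Ω : Type*} [MeasurableSpace Ω]
    {μ : Measure Ω} {X : Ω → scaledSimplex d} (hX : HasLaw X P.toMeasure μ) :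
    IsNormalizedGenerator μ (fun ω => (X ω : Fin d → ℝ)) N where
  left :=
    { aemeasurable := measurable_subtype_coe.comp_aemeasurable hX.aemeasurable
      nonneg := ae_of_all _ fun ω => (X ω).2.1
      integrable := fun i =>
        Integrable.comp_aemeasurable (g := fun z : scaledSimplex d => (z : Fin d → ℝ) i)
          (hX.map_eq ▸ hP.1.integrable i) hX.aemeasurable
      mean_one := fun i =>
        (hX.integral_comp (continuous_coord i).aestronglyMeasurable).trans (hP.1.mean_one i)
      eq_integral := fun x => (hP.1.eq_integral x).trans
        (hX.integral_comp (continuous_norm_mul x).aestronglyMeasurable).symm }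
  right := ae_of_all _ fun ω => (X ω).2.2

theorem DNorm.isNormalizedGenerator_law (hd : 1 ≤ d) (D : DNorm d) :
    IsNormalizedGenerator (D.law hd).1.toMeasure Subtype.val D.toFun :=
  isNormalizedGenerator_subtype_val (D.law hd).2 (D.toFun_eq hd)

/-- Pairs of normalized generators are, up to null sets, exactly pairs of simplex-valued variables
with the associated laws, at equal cost. -/
theorem DNorm.distW_eq_law (hd : 1 ≤ d) (D₁ D₂ : DNorm d) :
    D₁.distW D₂ = (D₁.law hd).1.distW (D₂.law hd).1 := by
  refine congrArg sInf (Set.ext fun r => ⟨?_, ?_⟩)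
  · rintro ⟨Ω, _, μ, _, Z₁, Z₂, h₁, h₂, rfl⟩
    obtain ⟨X, hX, hXZ⟩ := DNorm.exists_hasLaw hd h₁
    obtain ⟨Y, hY, hYZ⟩ := DNorm.exists_hasLaw hd h₂
    refine ⟨Ω, _, μ, ‹_›, X, Y, hX, hY, integral_congr_ae ?_⟩
    filter_upwards [hXZ, hYZ] with ω hx hy
    rw [hx, hy]
  · rintro ⟨Ω, _, μ, _, X, Y, hX, hY, rfl⟩
    exact ⟨Ω, _, μ, ‹_›, _, _,
      isNormalizedGenerator_of_hasLaw (D₁.isNormalizedGenerator_law hd) hX,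
      isNormalizedGenerator_of_hasLaw (D₂.isNormalizedGenerator_law hd) hY, rfl⟩

attribute [local instance] SimplexLaw.metricSpace

/-- The Wasserstein metric on the `D`-norms. -/
@[reducible] def DNorm.metricSpace (hd : 1 ≤ d) : MetricSpace (DNorm d) where
  dist := DNorm.distW
  dist_self D := by rw [D.distW_eq_law hd, SimplexLaw.distW_self]
  dist_comm D₁ D₂ := by rw [D₁.distW_eq_law hd, D₂.distW_eq_law hd, SimplexLaw.distW_comm]
  dist_triangle D₁ D₂ D₃ := by
    rw [D₁.distW_eq_law hd, D₁.distW_eq_law hd, D₂.distW_eq_law hd]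
    exact SimplexLaw.distW_triangle _ _ _
  eq_of_dist_eq_zero {D₁ D₂} h := by
    rw [D₁.distW_eq_law hd] at h
    exact (DNorm.law_bijective hd).1 (Subtype.ext (SimplexLaw.eq_of_distW_eq_zero h))

end DNormLaw

end

theorem mainTheorem1 (d : ℕ) (hd : 1 ≤ d) :
    -- `d_W` is a metric on the laws on `S_d` and a metric on the `D`-norms
    ∃ (_ : MetricSpace (SimplexLaw d)) (_ : MetricSpace (DNorm d)),
      (∀ P Q : SimplexLaw d, dist P Q = P.distW Q) ∧
      (∀ D₁ D₂ : DNorm d, dist D₁ D₂ = D₁.distW D₂) ∧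
      -- the Wasserstein space is complete and separable
      CompleteSpace (SimplexLaw d) ∧ TopologicalSpace.SeparableSpace (SimplexLaw d) ∧
      -- the laws with means one form a closed, complete and separable subspace
      IsClosed (meanOneLaws d) ∧
      CompleteSpace (meanOneLaws d) ∧ TopologicalSpace.SeparableSpace (meanOneLaws d) ∧
      -- identification of a `D`-norm with the unique law of its normalized generators
      (∃ law : DNorm d ≃ meanOneLaws d,
        (∀ D : DNorm d,
          IsNormalizedGenerator (law D).1.toMeasure Subtype.val D.toFun) ∧
        (∀ (D : DNorm d) (Ω : Type*) (_ : MeasurableSpace Ω) (μ : Measure Ω)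
          (_ : IsProbabilityMeasure μ) (Z : Ω → Fin d → ℝ), IsNormalizedGenerator μ Z D.toFun →
            HasLaw Z ((law D).1.toMeasure.map Subtype.val) μ) ∧
        Isometry law) ∧
      -- the space of `D`-norms is complete and separable
      CompleteSpace (DNorm d) ∧ TopologicalSpace.SeparableSpace (DNorm d) := by
  let _ : MetricSpace (SimplexLaw d) := SimplexLaw.metricSpace d
  let _ : MetricSpace (DNorm d) := DNorm.metricSpace hd
  have hc : CompleteSpace (SimplexLaw d) := SimplexLaw.completeSpace
  have hs : TopologicalSpace.SeparableSpace (SimplexLaw d) := SimplexLaw.separableSpace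
  have hcl : IsClosed (meanOneLaws d) := isClosed_meanOneLaws
  have hc' : CompleteSpace (meanOneLaws d) := hcl.completeSpace_coe
  have : SecondCountableTopology (SimplexLaw d) := UniformSpace.secondCountable_of_separable _
  have hs' : TopologicalSpace.SeparableSpace (meanOneLaws d) := inferInstance
  let law : DNorm d ≃ meanOneLaws d := Equiv.ofBijective _ (DNorm.law_bijective hd)
  have hiso : Isometry law := Isometry.of_dist_eq fun D₁ D₂ => (D₁.distW_eq_law hd D₂).symm
  let e : DNorm d ≃ᵢ meanOneLaws d := ⟨law, hiso⟩
  refine ⟨_, _, fun _ _ => rfl, fun _ _ => rfl, hc, hs, hcl, hc', hs',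
    ⟨law, fun D => D.isNormalizedGenerator_law hd, fun D Ω _ μ _ Z hZ => ?_, hiso⟩,
    e.completeSpace, e.symm.surjective.denseRange.separableSpace e.symm.continuous⟩
  obtain ⟨X, hX, hXZ⟩ := DNorm.exists_hasLaw hd hZ
  exact (HasLaw.comp ⟨measurable_subtype_coe.aemeasurable, rfl⟩ hX).congr hXZ
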